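/- **Setting.** Let $m\ge 0$, let $X=\{x_0,x_1,\dots,x_m\}$, and let $X^*$ be the set of words over $X$, with empty word $\emptyset$. For $c,d\in\mathbb R^m\langle\langle X\rangle\rangle$ (formal power series with components $c_i,d_i$, $1\le i\le m$) and a series $e\in\mathbb R\langle\langle X\rangle\rangle$ put $\phi_d(\emptyset)=\mathrm{id}$, $\phi_d(x_k\eta)=\phi_d(x_k)\circ\phi_d(\eta)$, where $\phi_d(x_k)(e)=x_ke+x_0(d_k ⧢ e)$, $d_0:=0$, and $⧢$ is the shuffle product. The modified composition product is $e\,\tilde\circ\, d=\sum_{\eta\in X^*}(e,\eta)\,\phi_d(\eta)(1)$, taken componentwise for $c\,\tilde\circ\,d$, and the product of the output feedback group is $c\circledcirc d=d+c\,\tilde\circ\, d$ (that is, $(\delta+c)\circ(\delta+d)=\delta+c\circledcirc d$). Let $a^i_\eta(c)=(c_i,\eta)$ be the coordinate maps, $V_+$ the real vector space with basis $\{a^i_\eta: 1\le i\le m,\ \eta\in X^*\}$, and $H$ the free unital commutative $\mathbb R$-algebra on the $a^i_\eta$, with product $\mu$ and unit $\mathbf 1$, so that $V_+\subset H$. Put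 $\deg a^i_\eta=2|\eta|_{x_0}+\sum_{j=1}^m|\eta|_{x_j}+1$, let $\varepsilon:H\to\mathbb R$ be the algebra morphism with $\varepsilon(a^i_\eta)=0$, and let $\theta_k a^i_\eta=a^i_{x_k\eta}$ for $0\le k\le m$, extended linearly to $V_+$. **Theorem.** There is exactly one algebra morphism $\Delta:H\to H\otimes H$ with $(\Delta a^i_\eta)(c,d)=a^i_\eta(c\circledcirc d)$ for all $c,d,i,\eta$. With $\Delta$ and $\varepsilon$, $H$ is a bialgebra. The identity of $H$ has exactly one two-sided inverse $S$ for the convolution product among linear maps $H\to H$ (the antipode), and $S$ is an algebra morphism. Put $\tilde\Delta a=\Delta a-\mathbf 1\otimes a$ for $a\in V_+$, $\Delta'a=\Delta a-a\otimes\mathbf 1-\mathbf 1\otimes a$ for $a\in H$, and, for $1\le j\le m$, let $\Delta^j_{⧢}:V_+\to V_+\otimes V_+$ be the linear map with $\Delta^j_{⧢}a^i_\eta=\sum_{\xi,\nu\in X^*}(\xi⧢\nu,\eta)\,a^i_\xi\otimes a^j_\nu$. Then $S a^i_\eta$ is computed, for all $1\le i\le m$ and $\eta\in X^*$, by the following algorithm.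 1. $\Delta^j_{⧢}$ satisfies, and is computed on every $a^i_\eta$ by recursion on $\eta$ from, $\Delta^j_{⧢}a^i_\emptyset=a^i_\emptyset\otimes a^j_\emptyset$ and $\Delta^j_{⧢}\circ\theta_k=(\theta_k\otimes\mathrm{id}+\mathrm{id}\otimes\theta_k)\circ\Delta^j_{⧢}$, $0\le k\le m$. 2. $\tilde\Delta$ takes values in $V_+\otimes H$ and satisfies $\tilde\Delta a^i_\emptyset=a^i_\emptyset\otimes\mathbf 1$; $\tilde\Delta\circ\theta_k=(\theta_k\otimes\mathrm{id})\circ\tilde\Delta$ for $1\le k\le m$; and $$\tilde\Delta\circ\theta_0=(\theta_0\otimes\mathrm{id})\circ\tilde\Delta+\sum_{j=1}^m(\theta_j\otimes\mu)\circ(\tilde\Delta\otimes\mathrm{id})\circ\Delta^j_{⧢}.$$ These rules compute $\tilde\Delta$: unfolding them $|\eta|+1$ times, starting from an arbitrary linear map $V_+\to V_+\otimes H$ in place of $\tilde\Delta$, yields $\tilde\Delta a^i_\eta$. 3. $\Delta'a^i_\eta=\tilde\Delta a^i_\eta-a^i_\eta\otimes\mathbf 1=:\sum a'_{(1)}\otimes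 a'_{(2)}$, and $$S a^i_\eta=-a^i_\eta-\sum (S a'_{(1)})\,a'_{(2)}=-a^i_\eta-\sum a'_{(1)}\,(S a'_{(2)}).$$ Each of the two formulas computes $S$ (in the second, with $S$ extended multiplicatively from $V_+$ to $H$): unfolding it $\deg a^i_\eta$ times, starting from an arbitrary linear map $V_+\to H$ in place of $S$, yields $S a^i_\eta$. -/

import Mathlib

open scoped TensorProduct

namespace OutputFeedback

noncomputable section

/-! ### Words and formal power series -/

/-- Words over the alphabet `X = {x₀, x₁, …, xₘ}`; the letter `x_k` is `k : Fin (m + 1)`,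
so that `x_j` with `1 ≤ j ≤ m` is `j.succ` for `j : Fin m`. -/
abbrev Word (m : ℕ) : Type := List (Fin (m + 1))

/-- Formal power series `R⟨⟨X⟩⟩`, given by their coefficients. -/
abbrev Series (m : ℕ) (R : Type*) : Type _ := Word m → R

/-- `R^m⟨⟨X⟩⟩`, given by the component series. -/
abbrev VecSeries (m : ℕ) (R : Type*) : Type _ := Fin m → Series m R

/-- All shuffles of two words, listed with multiplicity:
`(x ξ) ⧢ (y ν) = x (ξ ⧢ (y ν)) + y ((x ξ) ⧢ ν)`. -/
def shuffleWords {α : Type*} : List α → List α → List (List α)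
  | [], ν => [ν]
  | x :: ξ, [] => [x :: ξ]
  | x :: ξ, y :: ν =>
      (shuffleWords ξ (y :: ν)).map (fun w => x :: w) ++
        (shuffleWords (x :: ξ) ν).map (fun w => y :: w)
  termination_by ξ ν => ξ.length + ν.length

/-- The coefficient `(ξ ⧢ ν, η)`. -/
def shuffleCoeff {m : ℕ} (ξ ν η : Word m) : ℕ := (shuffleWords ξ ν).count η

theorem length_of_mem_shuffleWords {α : Type*} (ξ ν : List α) :
    ∀ w ∈ shuffleWords ξ ν, w.length = ξ.length + ν.length := by
  induction ξ, ν using shuffleWords.induct with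
  | case1 ν => intro w hw; simp [shuffleWords] at hw; simp [hw]
  | case2 x ξ => intro w hw; simp [shuffleWords] at hw; simp [hw]
  | case3 x ξ y ν ih₁ ih₂ =>
    intro w hw
    simp only [shuffleWords, List.mem_append, List.mem_map] at hw
    rcases hw with ⟨v, hv, rfl⟩ | ⟨v, hv, rfl⟩
    · have := ih₁ v hv
      simp only [List.length_cons] at this ⊢
      omega
    · have := ih₂ v hv
      simp only [List.length_cons] at this ⊢
      omega

theorem shuffleCoeff_eq_zero {m : ℕ} {ξ ν η : Word m}
    (h : η.length ≠ ξ.length + ν.length) : shuffleCoeff ξ ν η = 0 :=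
  List.count_eq_zero.2 fun hm => h (length_of_mem_shuffleWords ξ ν η hm)

/-- Only finitely many pairs of words have a given word among their shuffles. -/
theorem finite_shuffleCoeff {m : ℕ} (η : Word m) :
    {p : Word m × Word m | shuffleCoeff p.1 p.2 η ≠ 0}.Finite := by
  have hf : {w : Word m | w.length ≤ η.length}.Finite :=
    List.finite_length_le (Fin (m + 1)) η.length
  refine (hf.prod hf).subset ?_
  rintro ⟨ξ, ν⟩ hp
  have : η.length = ξ.length + ν.length := by
    by_contra hne
    exact hp (shuffleCoeff_eq_zero hne)
  simp only [Set.mem_prod, Set.mem_ofPred_eq]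
  omega

/-- The shuffle product of two series. The sum has finite support
by `finite_shuffleCoeff`. -/
def shuffle {m : ℕ} {R : Type*} [CommRing R] (c d : Series m R) : Series m R :=
  fun η => ∑ᶠ p : Word m × Word m, (shuffleCoeff p.1 p.2 η : R) * (c p.1 * d p.2)

/-- Left concatenation `e ↦ x_k e` on series. -/
def letterMul {m : ℕ} {R : Type*} [CommRing R] (k : Fin (m + 1)) (e : Series m R) :
    Series m R
  | [] => 0
  | l :: η => if l = k then e η else 0

/-- The series `1 = 1 ∅`. -/
def oneSeries (m : ℕ) (R : Type*) [CommRing R] : Series m R :=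
  fun η => if η = [] then 1 else 0

/-- `φ_d(x_k)(e) = x_k e + x₀ (d_k ⧢ e)`, with `d₀ = 0`. -/
def phiLetter {m : ℕ} {R : Type*} [CommRing R] (d : VecSeries m R) (k : Fin (m + 1))
    (e : Series m R) : Series m R :=
  letterMul k e +
    letterMul 0 (shuffle (Fin.cases (motive := fun _ => Series m R) 0 d k) e)

/-- `φ_d(∅) = id` and `φ_d(x_k η) = φ_d(x_k) ∘ φ_d(η)`. -/
def phiWord {m : ℕ} {R : Type*} [CommRing R] (d : VecSeries m R) :
    Word m → Series m R → Series m R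
  | [], e => e
  | k :: η, e => phiLetter d k (phiWord d η e)

/-- The modified composition product `c ∘̃ d = ∑_η (c, η) φ_d(η)(1)` of a series `c` and
`d ∈ R^m⟨⟨X⟩⟩`. The coefficientwise sum has finite support by `finite_phiWord`. -/
def modComp {m : ℕ} {R : Type*} [CommRing R] (c : Series m R) (d : VecSeries m R) :
    Series m R :=
  fun ξ => ∑ᶠ η : Word m, c η * phiWord d η (oneSeries m R) ξ

theorem shuffle_eq_zero_of_length {m : ℕ} {R : Type*} [CommRing R] (c e : Series m R)
    (n : ℕ) (he : ∀ ξ : Word m, ξ.length < n → e ξ = 0) (ξ : Word m) (hξ : ξ.length < n) :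
    shuffle c e ξ = 0 := by
  refine finsum_eq_zero_of_forall_eq_zero fun p => ?_
  by_cases h : ξ.length = p.1.length + p.2.length
  · rw [he p.2 (by omega)]; simp
  · rw [shuffleCoeff_eq_zero h]; simp

/-- `φ_d(η)(1)` has no terms of length smaller than that of `η`. -/
theorem phiWord_eq_zero_of_length {m : ℕ} {R : Type*} [CommRing R] (d : VecSeries m R)
    (η : Word m) : ∀ ξ : Word m, ξ.length < η.length →
      phiWord d η (oneSeries m R) ξ = 0 := by
  induction η with
  | nil => intro ξ h; simp at h
  | cons k η ih =>
    intro ξ h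
    cases ξ with
    | nil => simp [phiWord, phiLetter, letterMul]
    | cons l ξ =>
      have h' : ξ.length < η.length := by simpa using h
      simp [phiWord, phiLetter, letterMul, ih ξ h',
        shuffle_eq_zero_of_length _ _ η.length ih ξ h']

theorem finite_phiWord {m : ℕ} {R : Type*} [CommRing R] (d : VecSeries m R) (ξ : Word m) :
    {η : Word m | phiWord d η (oneSeries m R) ξ ≠ 0}.Finite := by
  refine (List.finite_length_le (Fin (m + 1)) ξ.length).subset fun η hη => ?_
  by_contra hlt
  exact hη (phiWord_eq_zero_of_length d η ξ (by simpa using hlt))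

/-- The product of the output feedback group, transported from `δ + R^m⟨⟨X⟩⟩` to
`R^m⟨⟨X⟩⟩`: `(δ + c) ∘ (δ + d) = δ + (d + c ∘̃ d)`. -/
def groupProd {m : ℕ} {R : Type*} [CommRing R] (c d : VecSeries m R) : VecSeries m R :=
  fun i => d i + modComp (c i) d

/-! ### The algebra of coordinate functions -/

/-- Indices of the coordinate maps `a^i_η`. -/
abbrev Coord (m : ℕ) : Type := Fin m × Word m

/-- `V₊`, the real vector space with basis the coordinate maps `a^i_η`. -/
abbrev VPlus (m : ℕ) : Type := Coord m →₀ ℝ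

/-- `H`, the free unital commutative real algebra on the coordinate maps. -/
abbrev H (m : ℕ) : Type := MvPolynomial (Coord m) ℝ

/-- `a^i_η` as an element of `V₊`. -/
def aV {m : ℕ} (i : Fin m) (η : Word m) : VPlus m := Finsupp.single (i, η) 1

/-- `a^i_η` as an element of `H`. -/
def aH {m : ℕ} (i : Fin m) (η : Word m) : H m := MvPolynomial.X (i, η)

/-- The inclusion `V₊ ⊆ H`. -/
def incl (m : ℕ) : VPlus m →ₗ[ℝ] H m :=
  Finsupp.linearCombination ℝ fun p : Coord m => aH p.1 p.2

/-- `deg a^i_η = 2 |η|_{x₀} + ∑_{j=1}^m |η|_{x_j} + 1`. -/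
def deg {m : ℕ} (η : Word m) : ℕ := 2 * η.count 0 + ∑ j : Fin m, η.count j.succ + 1

/-- Evaluation of an element of `H` at a series `c`: the character of `H` with
`a^i_η ↦ (c_i, η)`. -/
def eval {m : ℕ} (c : VecSeries m ℝ) : H m →ₐ[ℝ] ℝ :=
  MvPolynomial.aeval fun p : Coord m => c p.1 p.2

/-- Evaluation of an element of `H ⊗ H` at a pair of series:
`(f ⊗ g)(c, d) = f(c) g(d)`. -/
def evalPair {m : ℕ} (c d : VecSeries m ℝ) : H m ⊗[ℝ] H m →ₐ[ℝ] ℝ :=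
  Algebra.TensorProduct.productMap (eval c) (eval d)

/-- `Δ` has the defining property of the coproduct of the output feedback group:
`(Δ a^i_η)(c, d)` is the coefficient of `η` in the `i`-th component of the product
of `c` and `d`. -/
def RepresentsProduct {m : ℕ} (Δ : H m →ₐ[ℝ] H m ⊗[ℝ] H m) : Prop :=
  ∀ (c d : VecSeries m ℝ) (i : Fin m) (η : Word m),
    evalPair c d (Δ (aH i η)) = groupProd c d i η

/-- The coproduct `Δ` of `H`: the algebra morphism that sends `a^i_η` to the
corresponding coefficient of the group product of the two generic series with coefficients
`a^i_η ⊗ 1` and `1 ⊗ a^i_η`. -/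
def coproduct (m : ℕ) : H m →ₐ[ℝ] H m ⊗[ℝ] H m :=
  MvPolynomial.aeval fun p : Coord m =>
    groupProd (R := H m ⊗[ℝ] H m) (fun i η => aH i η ⊗ₜ[ℝ] 1) (fun i η => 1 ⊗ₜ[ℝ] aH i η)
      p.1 p.2

/-- The counit `ε` of `H`: `ε(a^i_η) = 0`, `ε(1) = 1`. -/
def counit (m : ℕ) : H m →ₐ[ℝ] ℝ := MvPolynomial.aeval fun _ => 0

/-- `Δ` and `ε` make the algebra `H` a bialgebra. -/
def IsBialgebra {m : ℕ} (Δ : H m →ₐ[ℝ] H m ⊗[ℝ] H m) (ε : H m →ₐ[ℝ] ℝ) : Prop :=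
  (∀ a : H m, TensorProduct.assoc ℝ (H m) (H m) (H m)
      (TensorProduct.map Δ.toLinearMap LinearMap.id (Δ a)) =
        TensorProduct.map LinearMap.id Δ.toLinearMap (Δ a)) ∧
  (∀ a : H m, TensorProduct.map ε.toLinearMap LinearMap.id (Δ a) = (1 : ℝ) ⊗ₜ[ℝ] a) ∧
  (∀ a : H m, TensorProduct.map LinearMap.id ε.toLinearMap (Δ a) = a ⊗ₜ[ℝ] (1 : ℝ))

/-- `S` is an antipode: it is the two-sided inverse of `id` for the convolution product. -/
def IsAntipode {m : ℕ} (Δ : H m →ₐ[ℝ] H m ⊗[ℝ] H m) (ε : H m →ₐ[ℝ] ℝ)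
    (S : H m →ₗ[ℝ] H m) : Prop :=
  (∀ a : H m, LinearMap.mul' ℝ (H m) (TensorProduct.map S LinearMap.id (Δ a)) =
    algebraMap ℝ (H m) (ε a)) ∧
  (∀ a : H m, LinearMap.mul' ℝ (H m) (TensorProduct.map LinearMap.id S (Δ a)) =
    algebraMap ℝ (H m) (ε a))

/-- `Δ̃ a = Δ a - 1 ⊗ a` on `V₊`. -/
def tildeCoproduct (m : ℕ) : VPlus m →ₗ[ℝ] H m ⊗[ℝ] H m :=
  (coproduct m).toLinearMap ∘ₗ incl m - TensorProduct.mk ℝ (H m) (H m) 1 ∘ₗ incl m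

/-- The reduced coproduct `Δ' a = Δ a - a ⊗ 1 - 1 ⊗ a`. -/
def reducedCoproduct {m : ℕ} (a : H m) : H m ⊗[ℝ] H m :=
  coproduct m a - a ⊗ₜ[ℝ] 1 - 1 ⊗ₜ[ℝ] a

/-- The shuffle coproduct `Δ_⧢^j a^i_η = ∑_{ξ, ν} (ξ ⧢ ν, η) a^i_ξ ⊗ a^j_ν`, the adjoint of
the shuffle product in the coordinates. The sum has finite support
by `finite_shuffleCoeff`. -/
def shuffleCoproduct {m : ℕ} (j : Fin m) : VPlus m →ₗ[ℝ] VPlus m ⊗[ℝ] VPlus m :=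
  Finsupp.linearCombination ℝ fun p : Coord m =>
    ∑ᶠ q : Word m × Word m, shuffleCoeff q.1 q.2 p.2 • (aV p.1 q.1 ⊗ₜ[ℝ] aV j q.2)

/-- The endomorphism `θ_k a^i_η = a^i_{x_k η}` of `V₊`. -/
def theta {m : ℕ} (k : Fin (m + 1)) : VPlus m →ₗ[ℝ] VPlus m :=
  Finsupp.lmapDomain ℝ ℝ fun p : Coord m => (p.1, k :: p.2)

/-- `θ_k ⊗ id + id ⊗ θ_k` on `V₊ ⊗ V₊`. -/
def thetaSum {m : ℕ} (k : Fin (m + 1)) :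
    VPlus m ⊗[ℝ] VPlus m →ₗ[ℝ] VPlus m ⊗[ℝ] VPlus m :=
  TensorProduct.map (theta k) LinearMap.id + TensorProduct.map LinearMap.id (theta k)

/-- `θ_k ⊗ id` on `V₊ ⊗ H`. -/
def thetaLeft {m : ℕ} (k : Fin (m + 1)) :
    VPlus m ⊗[ℝ] H m →ₗ[ℝ] VPlus m ⊗[ℝ] H m :=
  TensorProduct.map (theta k) LinearMap.id

/-- `(θ_j ⊗ μ) ∘ (D ⊗ id) : V₊ ⊗ V₊ → V₊ ⊗ H` for `D : V₊ → V₊ ⊗ H`. -/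
def thetaMul {m : ℕ} (j : Fin m) (D : VPlus m →ₗ[ℝ] VPlus m ⊗[ℝ] H m) :
    VPlus m ⊗[ℝ] VPlus m →ₗ[ℝ] VPlus m ⊗[ℝ] H m :=
  TensorProduct.map (theta j.succ) (LinearMap.mul' ℝ (H m)) ∘ₗ
    (TensorProduct.assoc ℝ (VPlus m) (H m) (H m)).toLinearMap ∘ₗ
      TensorProduct.map D (incl m)

/-! ### The algorithm -/

/-- Step i, on a coordinate map: recursion on the word. -/
def shuffleRec {m : ℕ} (j i : Fin m) : Word m → VPlus m ⊗[ℝ] VPlus m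
  | [] => aV i [] ⊗ₜ[ℝ] aV j []
  | k :: η => thetaSum k (shuffleRec j i η)

/-- Step i: the linear map on `V₊` computed by the recursion. -/
def algShuffle {m : ℕ} (j : Fin m) : VPlus m →ₗ[ℝ] VPlus m ⊗[ℝ] VPlus m :=
  Finsupp.linearCombination ℝ fun p : Coord m => shuffleRec j p.1 p.2

/-- One unfolding of the recursion of step ii, where `D` supplies the values of the
recursive calls. -/
def tildeStep {m : ℕ} (D : VPlus m →ₗ[ℝ] VPlus m ⊗[ℝ] H m) :
    VPlus m →ₗ[ℝ] VPlus m ⊗[ℝ] H m :=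
  Finsupp.linearCombination ℝ fun p : Coord m =>
    match p with
    | (i, []) => aV i [] ⊗ₜ[ℝ] (1 : H m)
    | (i, k :: η) =>
        if k = 0 then
          thetaLeft 0 (D (aV i η)) + ∑ j : Fin m, thetaMul j D (algShuffle j (aV i η))
        else thetaLeft k (D (aV i η))

/-- Step ii: the linear map `V₊ → V₊ ⊗ H` computed by unfolding the recursion `|η| + 1` times
on each `a^i_η`. -/
def algTilde (m : ℕ) : VPlus m →ₗ[ℝ] VPlus m ⊗[ℝ] H m :=
  Finsupp.linearCombination ℝ fun p : Coord m =>
    (tildeStep^[p.2.length + 1]) 0 (aV p.1 p.2)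

/-- The reduced coproduct as provided by step ii: `a^i_η ↦ Δ̃ a^i_η - a^i_η ⊗ 1`. -/
def algReduced (m : ℕ) : VPlus m →ₗ[ℝ] VPlus m ⊗[ℝ] H m :=
  Finsupp.linearCombination ℝ fun p : Coord m =>
    algTilde m (aV p.1 p.2) - aV p.1 p.2 ⊗ₜ[ℝ] (1 : H m)

/-- One unfolding of the recursion `S a = -a - ∑ (S a'₍₁₎) a'₍₂₎` of step iii, where `S`
supplies the values of the recursive calls. -/
def antipodeStepLeft {m : ℕ} (S : VPlus m →ₗ[ℝ] H m) : VPlus m →ₗ[ℝ] H m :=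
  -incl m - LinearMap.mul' ℝ (H m) ∘ₗ TensorProduct.map S LinearMap.id ∘ₗ algReduced m

/-- One unfolding of the recursion `S a = -a - ∑ a'₍₁₎ (S a'₍₂₎)` of step iii, where `S`
supplies the values on the coordinate maps, extended multiplicatively to `H`. -/
def antipodeStepRight {m : ℕ} (S : VPlus m →ₗ[ℝ] H m) : VPlus m →ₗ[ℝ] H m :=
  -incl m - LinearMap.mul' ℝ (H m) ∘ₗ
    TensorProduct.map (incl m)
      (MvPolynomial.aeval (R := ℝ) fun p : Coord m => S (aV p.1 p.2)).toLinearMap ∘ₗ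
        algReduced m

end

end OutputFeedback

open scoped TensorProduct

namespace OutputFeedback

noncomputable section

/-! ### Recursion for the shuffle product -/

/-! Everything rests on two recursions along the first letter. The left derivatives x_k⁻¹ are
derivations of the shuffle product (`shuffle_cons`). For the composition product, x_j⁻¹(c ∘̃ d) =
(x_j⁻¹c) ∘̃ d if j ≥ 1, while x₀⁻¹(c ∘̃ d) = (x₀⁻¹c) ∘̃ d + ∑_j d_j ⧢ ((x_j⁻¹c) ∘̃ d)
(`modComp_cons`). Induction on length then shows that c ↦ c ∘̃ d respects shuffles and that (c ∘̃ d)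
∘̃ e = c ∘̃ (d ⊚ e). So ⊚ is associative with unit 0 over every commutative ring. The inverse of c
is the fixed point of s ↦ -(c ∘̃ s); iteration reaches it because the coefficient of c ∘̃ s at η
sees s only on words shorter than η.

These constructions commute with ring homomorphisms (`map_groupProd`). Hence Δ is the product of two
generic series over H ⊗ H, the bialgebra axioms are the monoid laws for generic series, and the
antipode is given by the inverse of the generic series. Δ is unique because real polynomials are
determined by their values, S because two-sided inverses in the convolution monoid are unique.

The rules for Δ̃ are the recursion for ∘̃ read on coordinates (`modComp_eq_map_algTilde`), and they
only call shorter words. Finally, both factors of Δ' a involve only coordinates of degree less than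
deg a (`algReduced_mem_lowerTensor`), since x₀ weighs more than the x_j that replaces it. Induction
on the degree shows that both recursions for S end at the antipode. -/

/-- The left derivative `x_k⁻¹ c` of a series. -/
def lderiv {m : ℕ} {R : Type*} (k : Fin (m + 1)) (c : Series m R) : Series m R :=
  fun η => c (k :: η)

@[simp] theorem lderiv_apply {m : ℕ} {R : Type*} (k : Fin (m + 1)) (c : Series m R)
    (η : Word m) : lderiv k c η = c (k :: η) := rfl

theorem lderiv_add {m : ℕ} {R : Type*} [Add R] (k : Fin (m + 1)) (c d : Series m R) :
    lderiv k (c + d) = lderiv k c + lderiv k d := rfl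

theorem shuffleWords_nil_right {α : Type*} (ξ : List α) : shuffleWords ξ [] = [ξ] := by
  cases ξ <;> simp [shuffleWords]

/-- A function on words, pushed forward along `ξ ↦ x_k ξ`. -/
def consExtend {m : ℕ} {M : Type*} [Zero M] (k : Fin (m + 1)) (f : Word m → M) : Word m → M
  | [] => 0
  | l :: ξ => if l = k then f ξ else 0

theorem count_map_cons {α : Type*} [DecidableEq α] (l k : α) (η : List α)
    (L : List (List α)) :
    (L.map (fun w => l :: w)).count (k :: η) = if l = k then L.count η else 0 := by
  split_ifs with h
  · subst h
    exact List.count_map_of_injective L (fun w => l :: w) (List.cons_injective) η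
  · rw [List.count_eq_zero]
    simp [h]

/-- The first letter of a shuffle is the first letter of ξ or that of ν; `consExtend` records that
this letter must be x_k. -/
theorem shuffleCoeff_cons {m : ℕ} (ξ ν η : Word m) (k : Fin (m + 1)) :
    shuffleCoeff ξ ν (k :: η) =
      consExtend k (fun ξ' => shuffleCoeff ξ' ν η) ξ +
        consExtend k (fun ν' => shuffleCoeff ξ ν' η) ν := by
  cases ξ with
  | nil =>
    cases ν with
    | nil => simp [shuffleCoeff, shuffleWords, consExtend]
    | cons y ν => simp [shuffleCoeff, shuffleWords, consExtend, List.count_singleton]; grind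
  | cons x ξ =>
    cases ν with
    | nil =>
      simp [shuffleCoeff, consExtend, List.count_singleton,
        shuffleWords_nil_right]; grind
    | cons y ν =>
      simp only [shuffleCoeff, shuffleWords, consExtend, List.count_append, count_map_cons]

theorem shuffleCoeff_nil {m : ℕ} (ξ ν : Word m) :
    shuffleCoeff ξ ν [] = if ξ = [] ∧ ν = [] then 1 else 0 := by
  split_ifs with h
  · simp [h.1, h.2, shuffleCoeff, shuffleWords]
  · apply shuffleCoeff_eq_zero
    have : ξ.length ≠ 0 ∨ ν.length ≠ 0 := by simpa [or_iff_not_imp_left] using h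
    simp only [List.length_nil]
    omega

/-- The sum of `f (ξ, ν)` over all pairs of words, with multiplicities `(ξ ⧢ ν, η)`. -/
def shuffleSum {m : ℕ} {M : Type*} [AddCommMonoid M] (f : Word m × Word m → M)
    (η : Word m) : M :=
  ∑ᶠ q : Word m × Word m, shuffleCoeff q.1 q.2 η • f q

theorem shuffleSum_nil {m : ℕ} {M : Type*} [AddCommMonoid M] (f : Word m × Word m → M) :
    shuffleSum f [] = f ([], []) := by
  rw [shuffleSum, finsum_eq_single _ ([], [])]
  · simp [shuffleCoeff_nil]
  · rintro ⟨ξ, ν⟩ h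
    rw [shuffleCoeff_nil, if_neg (by simpa using h), zero_smul]

theorem finsum_eq_finsum_comp {α β M : Type*} [AddCommMonoid M] (g : α → β)
    (hg : Function.Injective g) (f : β → M) (hf : ∀ b ∉ Set.range g, f b = 0) :
    ∑ᶠ b, f b = ∑ᶠ a, f (g a) := by
  rw [← finsum_mem_range hg, finsum_mem_def, Set.indicator_eq_self.2]
  intro b hb
  by_contra h
  exact hb (hf b h)

/-- With `shuffleSum_nil`, this replaces the finite sum over pairs of words by a recursion on η,
through which the shuffle product and the shuffle coproduct are both handled. -/
theorem shuffleSum_cons {m : ℕ} {M : Type*} [AddCommMonoid M] (f : Word m × Word m → M)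
    (k : Fin (m + 1)) (η : Word m) :
    shuffleSum f (k :: η) =
      shuffleSum (fun q => f (k :: q.1, q.2)) η + shuffleSum (fun q => f (q.1, k :: q.2)) η := by
  simp only [shuffleSum, shuffleCoeff_cons, add_smul]
  rw [finsum_add_distrib]
  · congr 1
    · rw [finsum_eq_finsum_comp (fun q : Word m × Word m => (k :: q.1, q.2))]
      · simp [consExtend]
      · rintro ⟨a, b⟩ ⟨c, d⟩ h
        simpa using h
      · rintro ⟨_ | ⟨l, ξ⟩, ν⟩ h
        · simp [consExtend]
        · have : l ≠ k := by rintro rfl; exact h ⟨(ξ, ν), rfl⟩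
          simp [consExtend, this]
    · rw [finsum_eq_finsum_comp (fun q : Word m × Word m => (q.1, k :: q.2))]
      · simp [consExtend]
      · rintro ⟨a, b⟩ ⟨c, d⟩ h
        simpa using h
      · rintro ⟨ξ, _ | ⟨l, ν⟩⟩ h
        · simp [consExtend]
        · have : l ≠ k := by rintro rfl; exact h ⟨(ξ, ν), rfl⟩
          simp [consExtend, this]
  · refine (finite_shuffleCoeff (k :: η)).subset fun q hq h => hq ?_
    rw [shuffleCoeff_cons, Nat.add_eq_zero_iff] at h
    simp [h.1]
  · refine (finite_shuffleCoeff (k :: η)).subset fun q hq h => hq ?_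
    rw [shuffleCoeff_cons, Nat.add_eq_zero_iff] at h
    simp [h.2]

theorem map_shuffleSum {m : ℕ} {M N F : Type*} [AddCommMonoid M] [AddCommMonoid N]
    [FunLike F M N] [AddMonoidHomClass F M N] (g : F) (f : Word m × Word m → M) (η : Word m) :
    g (shuffleSum f η) = shuffleSum (fun q => g (f q)) η := by
  induction η generalizing f with
  | nil => simp [shuffleSum_nil]
  | cons k η ih => simp only [shuffleSum_cons, map_add, ih]

section Series

variable {m : ℕ} {R : Type*} [CommRing R]

theorem shuffle_eq_shuffleSum (c d : Series m R) (η : Word m) :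
    shuffle c d η = shuffleSum (fun q => c q.1 * d q.2) η := by
  simp [shuffle, shuffleSum]

@[simp] theorem shuffle_nil (c d : Series m R) : shuffle c d [] = c [] * d [] := by
  simp [shuffle_eq_shuffleSum, shuffleSum_nil]

@[simp] theorem shuffle_cons (c d : Series m R) (k : Fin (m + 1)) (η : Word m) :
    shuffle c d (k :: η) = shuffle (lderiv k c) d η + shuffle c (lderiv k d) η := by
  simp [shuffle_eq_shuffleSum, shuffleSum_cons]

theorem lderiv_shuffle (c d : Series m R) (k : Fin (m + 1)) :
    lderiv k (shuffle c d) = shuffle (lderiv k c) d + shuffle c (lderiv k d) := by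
  ext η; simp

theorem shuffle_congr {c c' d d' : Series m R} {η : Word m}
    (hc : ∀ ξ : Word m, ξ.length ≤ η.length → c ξ = c' ξ)
    (hd : ∀ ξ : Word m, ξ.length ≤ η.length → d ξ = d' ξ) :
    shuffle c d η = shuffle c' d' η := by
  induction η generalizing c c' d d' with
  | nil => simp [hc [] le_rfl, hd [] le_rfl]
  | cons k η ih =>
    rw [shuffle_cons, shuffle_cons]
    congr 1 <;> refine ih (fun ξ h => ?_) (fun ξ h => ?_) <;>
      first
      | exact hc _ (by simpa using h)
      | exact hd _ (by simpa using h)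
      | exact hc _ (h.trans (by simp))
      | exact hd _ (h.trans (by simp))

theorem shuffle_add_left (c c' d : Series m R) :
    shuffle (c + c') d = shuffle c d + shuffle c' d := by
  ext η
  induction η generalizing c c' d with
  | nil => simp [add_mul]
  | cons k η ih => simp only [shuffle_cons, lderiv_add, ih, Pi.add_apply]; ring

theorem shuffle_comm (c d : Series m R) : shuffle c d = shuffle d c := by
  ext η
  induction η generalizing c d with
  | nil => simp [mul_comm]
  | cons k η ih => rw [shuffle_cons, shuffle_cons, ih, ih c, add_comm]

theorem shuffle_add_right (c d d' : Series m R) :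
    shuffle c (d + d') = shuffle c d + shuffle c d' := by
  rw [shuffle_comm, shuffle_add_left, shuffle_comm d, shuffle_comm d']

theorem shuffle_assoc (c d e : Series m R) :
    shuffle (shuffle c d) e = shuffle c (shuffle d e) := by
  ext η
  induction η generalizing c d e with
  | nil => simp [mul_assoc]
  | cons k η ih =>
    simp only [shuffle_cons, lderiv_shuffle, shuffle_add_left, shuffle_add_right, ih,
      Pi.add_apply]
    ring

/-- Shuffling with a fixed series, as an additive map. -/
def shuffleHom (c : Series m R) : Series m R →+ Series m R where
  toFun := shuffle c
  map_zero' := by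
    have := shuffle_add_right c 0 0
    simpa using this
  map_add' := shuffle_add_right c

theorem shuffle_zero_right (c : Series m R) : shuffle c 0 = 0 := (shuffleHom c).map_zero

theorem shuffle_zero_left (c : Series m R) : shuffle 0 c = 0 := by
  rw [shuffle_comm, shuffle_zero_right]

theorem shuffle_sum_right {ι : Type*} (s : Finset ι) (c : Series m R) (d : ι → Series m R) :
    shuffle c (∑ i ∈ s, d i) = ∑ i ∈ s, shuffle c (d i) :=
  map_sum (shuffleHom c) d s

theorem finite_shuffle {ι : Type*} (c : Series m R) (φ : ι → Series m R)
    (hφ : ∀ ξ, (Function.support fun i => φ i ξ).Finite) (ξ : Word m) :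
    (Function.support fun i => shuffle c (φ i) ξ).Finite := by
  induction ξ generalizing c φ with
  | nil =>
    refine (hφ []).subset fun i hi h => hi ?_
    simp_all
  | cons k ξ ih =>
    simp only [shuffle_cons]
    exact ((ih (lderiv k c) φ hφ).union
      (ih c (fun i => lderiv k (φ i)) fun ξ => hφ (k :: ξ))).subset
        (Function.support_add _ _)

/-- Local finiteness of the family suffices, since the recursion on ξ reaches only finitely many
coefficients. -/
theorem shuffle_finsum {ι : Type*} (c : Series m R) (φ : ι → Series m R)
    (hφ : ∀ ξ, (Function.support fun i => φ i ξ).Finite) (ξ : Word m) :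
    shuffle c (fun ξ => ∑ᶠ i, φ i ξ) ξ = ∑ᶠ i, shuffle c (φ i) ξ := by
  induction ξ generalizing c φ with
  | nil => simpa using mul_finsum' _ _ (hφ [])
  | cons k ξ ih =>
    simp only [shuffle_cons]
    rw [finsum_add_distrib (finite_shuffle _ φ hφ ξ)
      (finite_shuffle c (fun i => lderiv k (φ i)) (fun ξ => hφ (k :: ξ)) ξ), ih _ φ hφ,
      ← ih c (fun i => lderiv k (φ i)) fun ξ => hφ (k :: ξ)]
    rfl

/-! ### Recursion for the modified composition product -/

theorem finsum_word {M : Type*} [AddCommMonoid M] (f : Word m → M)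
    (hf : (Function.support f).Finite) :
    ∑ᶠ η, f η = f [] + ∑ k : Fin (m + 1), ∑ᶠ η : Word m, f (k :: η) := by
  let g : Option (Fin (m + 1) × Word m) → Word m := fun o => o.elim [] fun p => p.1 :: p.2
  have hg : Function.Bijective g := by
    constructor
    · rintro (_ | ⟨k, η⟩) (_ | ⟨k', η'⟩) h <;> simp_all [g]
    · rintro (_ | ⟨k, η⟩)
      · exact ⟨none, rfl⟩
      · exact ⟨some (k, η), rfl⟩
  rw [← finsum_comp g hg, finsum_option]
  · rw [finsum_curry, finsum_eq_sum_of_fintype]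
    · rfl
    · exact (hf.preimage (f := fun p : Fin (m + 1) × Word m => p.1 :: p.2)
        (by rintro ⟨a, b⟩ _ ⟨c, d⟩ _ h; simpa using h))
  · exact hf.preimage (f := g ∘ some)
      (fun a _ b _ h => Option.some_injective _ (hg.1 h))

@[simp] theorem modComp_nil (c : Series m R) (d : VecSeries m R) : modComp c d [] = c [] := by
  rw [modComp, finsum_eq_single _ []]
  · simp [phiWord, oneSeries]
  · intro η hη
    rw [phiWord_eq_zero_of_length _ _ _ (by simpa [List.length_pos_iff] using hη), mul_zero]

theorem modComp_finite (c : Series m R) (d : VecSeries m R) (ξ : Word m) :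
    (Function.support fun η : Word m => c η * phiWord d η (oneSeries m R) ξ).Finite :=
  (finite_phiWord d ξ).subset fun η hη h => hη (by simp [h])

theorem shuffle_modComp (e c : Series m R) (d : VecSeries m R) (ξ : Word m) :
    shuffle e (modComp c d) ξ =
      ∑ᶠ η : Word m, c η * shuffle e (phiWord d η (oneSeries m R)) ξ := by
  have h := shuffle_finsum e (fun η ξ => c η * phiWord d η (oneSeries m R) ξ)
    (modComp_finite c d) ξ
  refine h.trans (finsum_congr fun η => ?_)
  generalize phiWord d η (oneSeries m R) = φ
  clear h
  induction ξ generalizing e φ with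
  | nil => simp; ring
  | cons k ξ ih =>
    simp only [shuffle_cons, mul_add, ← ih]
    rfl

/-- Split the sum over η by its first letter x_l. In φ_d(x_l)(e) = x_l e + x₀(d_l ⧢ e), the first
term contributes to x_k ξ only if l = k, the second only if k = 0. -/
theorem modComp_cons (c : Series m R) (d : VecSeries m R) (k : Fin (m + 1)) (ξ : Word m) :
    modComp c d (k :: ξ) = modComp (lderiv k c) d ξ +
      if k = 0 then ∑ j : Fin m, shuffle (d j) (modComp (lderiv j.succ c) d) ξ else 0 := by
  have e1 : ∀ l η, phiWord d (l :: η) (oneSeries m R) (k :: ξ) =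
      (if k = l then phiWord d η (oneSeries m R) ξ else 0) +
      if k = 0 then shuffle (Fin.cases (motive := fun _ => Series m R) 0 d l)
        (phiWord d η (oneSeries m R)) ξ else 0 := fun l η => rfl
  have e2 : phiWord d [] (oneSeries m R) (k :: ξ) = 0 := by simp [phiWord, oneSeries]
  rw [modComp, finsum_word _ (modComp_finite c d _), e2, mul_zero, zero_add]
  have e3 : ∀ l, ∑ᶠ η : Word m, c (l :: η) * phiWord d (l :: η) (oneSeries m R) (k :: ξ) =
      (if k = l then modComp (lderiv l c) d ξ else 0) +
      if k = 0 then shuffle (Fin.cases (motive := fun _ => Series m R) 0 d l)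
        (modComp (lderiv l c) d) ξ else 0 := by
    intro l
    simp only [e1, mul_add]
    rw [finsum_add_distrib]
    · congr 1
      · split_ifs <;> simp [modComp]
      · split_ifs
        · rw [shuffle_modComp]; rfl
        · simp
    · refine (modComp_finite (lderiv l c) d ξ).subset fun η hη h => hη ?_
      have h' : c (l :: η) * phiWord d η (oneSeries m R) ξ = 0 := h
      simp [h']
    · refine (finite_shuffle (Fin.cases (motive := fun _ => Series m R) 0 d l) _
        (finite_phiWord d) ξ).subset fun η hη h => hη ?_
      have h' : shuffle (Fin.cases (motive := fun _ => Series m R) 0 d l)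
        (phiWord d η (oneSeries m R)) ξ = 0 := h
      simp [h']
  simp only [e3, Finset.sum_add_distrib, Finset.sum_ite_eq, Finset.mem_univ, if_true]
  congr 1
  split_ifs
  -- The summand of the letter x₀ vanishes because d₀ = 0.
  · rw [Fin.sum_univ_succ]
    simp [shuffle_zero_left]
  · simp

end Series

/-! ### Agreement of series up to a given length -/

section EqBelow

variable {m : ℕ} {R : Type*}

/-- Two series agree on all words of length less than `n`. -/
def EqBelow (n : ℕ) (c d : Series m R) : Prop := ∀ ξ : Word m, ξ.length < n → c ξ = d ξ

theorem EqBelow.rfl {n : ℕ} {c : Series m R} : EqBelow n c c := fun _ _ => Eq.refl _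

theorem eq_of_eqBelow {c d : Series m R} (h : ∀ n, EqBelow n c d) : c = d :=
  funext fun ξ => h (ξ.length + 1) ξ (Nat.lt_succ_self _)

theorem EqBelow.zero {c d : Series m R} : EqBelow 0 c d := fun _ h => absurd h (Nat.not_lt_zero _)

theorem EqBelow.mono {n k : ℕ} {c d : Series m R} (h : EqBelow n c d) (hk : k ≤ n) :
    EqBelow k c d := fun ξ hξ => h ξ (hξ.trans_le hk)

theorem EqBelow.lderiv {n : ℕ} {c d : Series m R} (h : EqBelow (n + 1) c d) (k : Fin (m + 1)) :
    EqBelow n (lderiv k c) (lderiv k d) := fun ξ hξ => h (k :: ξ) (by simpa using hξ)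

theorem EqBelow.succ {n : ℕ} {c d : Series m R} (h0 : c [] = d [])
    (hz : EqBelow n (OutputFeedback.lderiv 0 c) (OutputFeedback.lderiv 0 d))
    (hs : ∀ j : Fin m, EqBelow n (OutputFeedback.lderiv j.succ c)
      (OutputFeedback.lderiv j.succ d)) : EqBelow (n + 1) c d := by
  rintro (_ | ⟨k, ξ⟩) h
  · exact h0
  · have h' : ξ.length < n := by simpa using h
    cases k using Fin.cases with
    | zero => exact hz ξ h'
    | succ j => exact hs j ξ h'

variable [CommRing R]

theorem EqBelow.add {n : ℕ} {c c' d d' : Series m R} (hc : EqBelow n c c')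
    (hd : EqBelow n d d') : EqBelow n (c + d) (c' + d') := fun ξ h => by
  simp only [Pi.add_apply, hc ξ h, hd ξ h]

theorem EqBelow.sum {n : ℕ} {ι : Type*} {s : Finset ι} {c c' : ι → Series m R}
    (h : ∀ i, EqBelow n (c i) (c' i)) : EqBelow n (∑ i ∈ s, c i) (∑ i ∈ s, c' i) :=
  fun ξ hξ => by simp only [Finset.sum_apply, h _ ξ hξ]

theorem EqBelow.shuffle {n : ℕ} {c c' d d' : Series m R} (hc : EqBelow n c c')
    (hd : EqBelow n d d') : EqBelow n (shuffle c d) (shuffle c' d') := fun _ h =>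
  shuffle_congr (fun ξ hξ => hc ξ (hξ.trans_lt h)) (fun ξ hξ => hd ξ (hξ.trans_lt h))

end EqBelow

/-! ### The output feedback group over a commutative ring -/

section Group

variable {m : ℕ} {R : Type*} [CommRing R]

theorem shuffle_left_comm (c d e : Series m R) :
    shuffle c (shuffle d e) = shuffle d (shuffle c e) := by
  rw [← shuffle_assoc, shuffle_comm c d, shuffle_assoc]

theorem shuffle_sum_left {ι : Type*} (s : Finset ι) (c : ι → Series m R) (d : Series m R) :
    shuffle (∑ i ∈ s, c i) d = ∑ i ∈ s, shuffle (c i) d := by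
  rw [shuffle_comm, shuffle_sum_right]
  exact Finset.sum_congr rfl fun _ _ => shuffle_comm _ _

theorem lderiv_modComp_zero (c : Series m R) (d : VecSeries m R) :
    lderiv 0 (modComp c d) =
      modComp (lderiv 0 c) d + ∑ j : Fin m, shuffle (d j) (modComp (lderiv j.succ c) d) := by
  ext ξ
  simp [modComp_cons]

theorem lderiv_modComp_succ (c : Series m R) (d : VecSeries m R) (j : Fin m) :
    lderiv j.succ (modComp c d) = modComp (lderiv j.succ c) d := by
  ext ξ
  simp [modComp_cons]

theorem modComp_add (c c' : Series m R) (d : VecSeries m R) :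
    modComp (c + c') d = modComp c d + modComp c' d := by
  ext ξ
  simp only [modComp, Pi.add_apply, add_mul]
  exact finsum_add_distrib (modComp_finite c d ξ) (modComp_finite c' d ξ)

/-- `c ↦ c ∘̃ d` as an additive map. -/
def modCompHom (d : VecSeries m R) : Series m R →+ Series m R where
  toFun c := modComp c d
  map_zero' := by
    have := modComp_add 0 0 d
    simpa using this
  map_add' c c' := modComp_add c c' d

theorem modComp_zero_left (d : VecSeries m R) : modComp 0 d = 0 := (modCompHom d).map_zero

theorem modComp_sum {ι : Type*} (s : Finset ι) (c : ι → Series m R) (d : VecSeries m R) :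
    modComp (∑ i ∈ s, c i) d = ∑ i ∈ s, modComp (c i) d :=
  map_sum (modCompHom d) c s

/-- The bound on d is one less than that on c: each factor d_j enters behind a letter x₀. This gain
makes the fixed point iteration for the inverse converge. -/
theorem EqBelow.modComp {n : ℕ} {c c' : Series m R} {d d' : VecSeries m R}
    (hc : EqBelow (n + 1) c c') (hd : ∀ i, EqBelow n (d i) (d' i)) :
    EqBelow (n + 1) (modComp c d) (modComp c' d') := by
  induction n generalizing c c' with
  | zero =>
    refine EqBelow.succ ?_ .zero fun _ => .zero
    simpa using hc [] (by simp)
  | succ n ih =>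
    have hd' i : EqBelow n (d i) (d' i) := (hd i).mono n.le_succ
    refine EqBelow.succ ?_ ?_ fun j => ?_
    · simpa using hc [] (by simp)
    · rw [lderiv_modComp_zero, lderiv_modComp_zero]
      exact (ih (hc.lderiv 0) hd').add (.sum fun j => (hd j).shuffle (ih (hc.lderiv _) hd'))
    · rw [lderiv_modComp_succ, lderiv_modComp_succ]
      exact ih (hc.lderiv _) hd'

/-- Both sides obey the same recursion: the left derivatives are derivations, and the correction
terms e_j ⧢ (x_j⁻¹ · ∘̃ e) again satisfy a Leibniz rule. -/
theorem modComp_shuffle (a b : Series m R) (e : VecSeries m R) :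
    modComp (shuffle a b) e = shuffle (modComp a e) (modComp b e) := by
  refine eq_of_eqBelow fun n => ?_
  induction n generalizing a b with
  | zero => exact .zero
  | succ n ih =>
    refine EqBelow.succ (by simp) ?_ fun j => ?_
    · simp only [lderiv_modComp_zero, lderiv_shuffle, modComp_add, shuffle_add_left,
        shuffle_add_right, Finset.sum_add_distrib, shuffle_sum_left, shuffle_sum_right]
      have h1 := ((ih (lderiv 0 a) b).add (ih a (lderiv 0 b))).add
        ((EqBelow.sum (s := Finset.univ) fun j : Fin m =>
            (EqBelow.rfl (c := e j)).shuffle (ih (lderiv j.succ a) b)).add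
          (EqBelow.sum (s := Finset.univ) fun j : Fin m =>
            (EqBelow.rfl (c := e j)).shuffle (ih a (lderiv j.succ b))))
      convert h1 using 1
      simp only [shuffle_assoc, shuffle_left_comm (modComp a e)]
      abel
    · simp only [lderiv_modComp_succ, lderiv_shuffle, modComp_add]
      exact (ih _ _).add (ih _ _)

/-- In the x₀-derivative of the left side, composing d_j ⧢ ((x_j⁻¹c) ∘̃ d) with e gives the factor
d_j ∘̃ e, by `modComp_shuffle`. The outer correction adds e_j, and e_j + d_j ∘̃ e is the j-th
component of d ⊚ e. -/
theorem modComp_modComp (c : Series m R) (d e : VecSeries m R) :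
    modComp (modComp c d) e = modComp c (groupProd d e) := by
  refine eq_of_eqBelow fun n => ?_
  induction n generalizing c with
  | zero => exact .zero
  | succ n ih =>
    refine EqBelow.succ (by simp) ?_ fun j => ?_
    · simp only [lderiv_modComp_zero, lderiv_modComp_succ, modComp_add, modComp_sum,
        modComp_shuffle]
      have h1 := (ih (lderiv 0 c)).add (EqBelow.sum (s := Finset.univ) fun j : Fin m =>
        (EqBelow.rfl (c := groupProd d e j)).shuffle (ih (lderiv j.succ c)))
      convert h1 using 1
      simp only [groupProd, shuffle_add_left, Finset.sum_add_distrib]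
      abel
    · simp only [lderiv_modComp_succ]
      exact ih _

theorem groupProd_assoc (c d e : VecSeries m R) :
    groupProd (groupProd c d) e = groupProd c (groupProd d e) := by
  funext i
  simp only [groupProd, modComp_add]
  rw [modComp_modComp, add_assoc]

theorem modComp_zero_right (c : Series m R) : modComp c 0 = c := by
  refine eq_of_eqBelow fun n => ?_
  induction n generalizing c with
  | zero => exact .zero
  | succ n ih =>
    refine EqBelow.succ (by simp) ?_ fun j => ?_
    · simpa [lderiv_modComp_zero, shuffle_zero_left] using ih _
    · simpa only [lderiv_modComp_succ] using ih _

theorem groupProd_zero_right (c : VecSeries m R) : groupProd c 0 = c := by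
  funext i
  simp [groupProd, modComp_zero_right]

theorem groupProd_zero_left (d : VecSeries m R) : groupProd 0 d = d := by
  funext i
  simp [groupProd, modComp_zero_left]

/-- The map whose fixed point is the inverse of `c` in the output feedback group. -/
def groupInvStep (c s : VecSeries m R) : VecSeries m R := fun i => -modComp (c i) s

/-- The inverse of `c` in the output feedback group. -/
def groupInv (c : VecSeries m R) : VecSeries m R :=
  fun i η => ((groupInvStep c)^[η.length + 1]) 0 i η

theorem eqBelow_iterate_groupInvStep (c : VecSeries m R) (n p : ℕ) (i : Fin m) :
    EqBelow n (((groupInvStep c)^[n]) 0 i) (((groupInvStep c)^[n + p]) 0 i) := by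
  induction n generalizing i with
  | zero => exact .zero
  | succ n ih =>
    intro ξ hξ
    rw [Nat.add_right_comm, Function.iterate_succ_apply', Function.iterate_succ_apply']
    exact congrArg Neg.neg (EqBelow.rfl.modComp ih ξ hξ)

theorem groupProd_groupInv (c : VecSeries m R) : groupProd c (groupInv c) = 0 := by
  funext i η
  have h : modComp (c i) (groupInv c) η =
      modComp (c i) (((groupInvStep c)^[η.length]) 0) η := by
    -- Only words ξ shorter than η matter on the right, and there the iterates from |ξ| + 1 on,
    -- hence also the |η|-th, agree.
    refine EqBelow.modComp (n := η.length) .rfl (fun j ξ hξ => ?_) η (Nat.lt_succ_self _)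
    obtain ⟨p, hp⟩ := Nat.exists_eq_add_of_le (Nat.succ_le_of_lt hξ)
    rw [hp]
    exact eqBelow_iterate_groupInvStep c (ξ.length + 1) p j ξ (Nat.lt_succ_self _)
  simp only [groupProd, Pi.add_apply, h, groupInv, Function.iterate_succ_apply',
    groupInvStep, Pi.neg_apply, neg_add_cancel, Pi.zero_apply]

/-- In a monoid where every element has a right inverse, right inverses are two-sided: c = c(c′c″) =
(cc′)c″ = c″. -/
theorem groupInv_groupProd (c : VecSeries m R) : groupProd (groupInv c) c = 0 := by
  have h : c = groupInv (groupInv c) := by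
    have h1 := groupProd_assoc c (groupInv c) (groupInv (groupInv c))
    rw [groupProd_groupInv, groupProd_groupInv, groupProd_zero_left, groupProd_zero_right] at h1
    exact h1.symm
  nth_rw 2 [h]
  exact groupProd_groupInv _

variable {A : Type*} [CommRing A]

theorem map_shuffle (f : R →+* A) (c d : Series m R) (η : Word m) :
    f (shuffle c d η) = shuffle (fun ξ => f (c ξ)) (fun ξ => f (d ξ)) η := by
  rw [shuffle_eq_shuffleSum, shuffle_eq_shuffleSum, map_shuffleSum]
  simp

theorem map_modComp (f : R →+* A) (c : Series m R) (d : VecSeries m R) (η : Word m) :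
    f (modComp c d η) = modComp (fun ξ => f (c ξ)) (fun i ξ => f (d i ξ)) η := by
  suffices h : ∀ n, EqBelow n (fun ξ => f (modComp c d ξ))
      (modComp (fun ξ => f (c ξ)) (fun i ξ => f (d i ξ))) from
    h _ η (Nat.lt_succ_self _)
  intro n
  induction n generalizing c with
  | zero => exact .zero
  | succ n ih =>
    refine EqBelow.succ (by simp) ?_ fun j => ?_
    · rw [lderiv_modComp_zero]
      have h1 := (ih (lderiv 0 c)).add (EqBelow.sum (s := Finset.univ) fun j : Fin m =>
        (EqBelow.rfl (c := fun ξ => f (d j ξ))).shuffle (ih (lderiv j.succ c)))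
      refine Eq.subst (motive := fun x => EqBelow n x _) ?_ h1
      funext ξ
      have := congrFun (lderiv_modComp_zero c d) ξ
      simp only [lderiv_apply] at this ⊢
      simp [this, map_shuffle]
    · rw [lderiv_modComp_succ]
      have h1 := ih (lderiv j.succ c)
      rw [← lderiv_modComp_succ] at h1
      exact h1

theorem map_groupProd (f : R →+* A) (c d : VecSeries m R) (i : Fin m) (η : Word m) :
    f (groupProd c d i η) = groupProd (fun i ξ => f (c i ξ)) (fun i ξ => f (d i ξ)) i η := by
  simp only [groupProd, Pi.add_apply, map_add, map_modComp]

end Group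

/-! ### The Hopf algebra of coordinate functions -/

section Hopf

variable {m : ℕ}

/-- The generic series with coefficients `a^i_η ⊗ 1`. -/
def genLeft (m : ℕ) : VecSeries m (H m ⊗[ℝ] H m) := fun i η => aH i η ⊗ₜ[ℝ] 1

/-- The generic series with coefficients `1 ⊗ a^i_η`. -/
def genRight (m : ℕ) : VecSeries m (H m ⊗[ℝ] H m) := fun i η => 1 ⊗ₜ[ℝ] aH i η

theorem coproduct_aH (i : Fin m) (η : Word m) :
    coproduct m (aH i η) = groupProd (genLeft m) (genRight m) i η := by
  simp only [coproduct, aH, MvPolynomial.aeval_X]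
  rfl

theorem map_coproduct_aH {A : Type*} [CommRing A] [Algebra ℝ A] (F : H m ⊗[ℝ] H m →ₐ[ℝ] A)
    (i : Fin m) (η : Word m) :
    F (coproduct m (aH i η)) =
      groupProd (fun i ξ => F (aH i ξ ⊗ₜ[ℝ] 1)) (fun i ξ => F (1 ⊗ₜ[ℝ] aH i ξ)) i η := by
  rw [coproduct_aH]
  exact map_groupProd (F : H m ⊗[ℝ] H m →+* A) _ _ i η

@[simp] theorem eval_aH (c : VecSeries m ℝ) (i : Fin m) (η : Word m) :
    eval c (aH i η) = c i η := by
  simp [eval, aH]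

theorem representsProduct_coproduct : RepresentsProduct (coproduct m) := by
  intro c d i η
  rw [map_coproduct_aH]
  simp [evalPair]

theorem algHom_ext_aH {A : Type*} [CommRing A] [Algebra ℝ A] {F G : H m →ₐ[ℝ] A}
    (h : ∀ i η, F (aH i η) = G (aH i η)) : F = G :=
  MvPolynomial.algHom_ext fun p => h p.1 p.2

/-- H ⊗ H is a polynomial ring on two copies of the coordinates, and a polynomial over the infinite
field ℝ is determined by its values. -/
theorem eq_of_evalPair {x y : H m ⊗[ℝ] H m} (h : ∀ c d, evalPair c d x = evalPair c d y) :
    x = y := by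
  apply (MvPolynomial.tensorEquivSum ℝ (Coord m) (Coord m) ℝ).injective
  apply MvPolynomial.funext
  intro z
  have key : (MvPolynomial.aeval z).comp
      (MvPolynomial.tensorEquivSum ℝ (Coord m) (Coord m) ℝ).toAlgHom =
      evalPair (fun i η => z (.inl (i, η))) (fun i η => z (.inr (i, η))) := by
    apply Algebra.TensorProduct.ext
    · refine algHom_ext_aH fun i η => ?_
      simp [evalPair]
      simp [aH]
    · refine algHom_ext_aH fun i η => ?_
      simp [evalPair]
      simp [aH]
  have := h (fun i η => z (.inl (i, η))) (fun i η => z (.inr (i, η)))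
  rw [← key] at this
  simpa [MvPolynomial.aeval_eq_eval] using this

theorem RepresentsProduct.eq_coproduct {Δ : H m →ₐ[ℝ] H m ⊗[ℝ] H m}
    (h : RepresentsProduct Δ) : Δ = coproduct m :=
  algHom_ext_aH fun i η => eq_of_evalPair fun c d => by
    rw [h c d i η, representsProduct_coproduct c d i η]

@[simp] theorem counit_aH (i : Fin m) (η : Word m) : counit m (aH i η) = 0 := by
  simp [counit, aH]

/-- By naturality, both sides send a^i_η to a coefficient of a triple product of the generic series
of the three tensor factors, so `groupProd_assoc` applies. -/
theorem coproduct_coassoc :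
    ((Algebra.TensorProduct.assoc ℝ ℝ ℝ (H m) (H m) (H m)).toAlgHom.comp
      (Algebra.TensorProduct.map (coproduct m) (AlgHom.id ℝ (H m)))).comp (coproduct m) =
    (Algebra.TensorProduct.map (AlgHom.id ℝ (H m)) (coproduct m)).comp (coproduct m) := by
  refine algHom_ext_aH (A := H m ⊗[ℝ] (H m ⊗[ℝ] H m)) fun i η => ?_
  let Y1 : VecSeries m (H m ⊗[ℝ] (H m ⊗[ℝ] H m)) := fun i η => aH i η ⊗ₜ[ℝ] (1 ⊗ₜ[ℝ] 1)
  let Y2 : VecSeries m (H m ⊗[ℝ] (H m ⊗[ℝ] H m)) := fun i η => 1 ⊗ₜ[ℝ] (aH i η ⊗ₜ[ℝ] 1)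
  let Y3 : VecSeries m (H m ⊗[ℝ] (H m ⊗[ℝ] H m)) := fun i η => 1 ⊗ₜ[ℝ] (1 ⊗ₜ[ℝ] aH i η)
  have hl : ∀ i η, Algebra.TensorProduct.assoc ℝ ℝ ℝ (H m) (H m) (H m)
      (coproduct m (aH i η) ⊗ₜ[ℝ] 1) = groupProd Y1 Y2 i η := fun i η =>
    map_coproduct_aH (A := H m ⊗[ℝ] (H m ⊗[ℝ] H m)) ((Algebra.TensorProduct.assoc ℝ ℝ ℝ (H m) (H m) (H m)).toAlgHom.comp
      (Algebra.TensorProduct.includeLeft (R := ℝ) (S := ℝ) (A := H m ⊗[ℝ] H m) (B := H m))) i η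
  have hr : ∀ i η, (1 : H m) ⊗ₜ[ℝ] coproduct m (aH i η) = groupProd Y2 Y3 i η := fun i η =>
    map_coproduct_aH (A := H m ⊗[ℝ] (H m ⊗[ℝ] H m))
      (Algebra.TensorProduct.includeRight (R := ℝ) (A := H m) (B := H m ⊗[ℝ] H m)) i η
  refine (map_coproduct_aH (A := H m ⊗[ℝ] (H m ⊗[ℝ] H m))
    ((Algebra.TensorProduct.assoc ℝ ℝ ℝ (H m) (H m) (H m)).toAlgHom.comp
      (Algebra.TensorProduct.map (coproduct m) (AlgHom.id ℝ (H m)))) i η).trans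
    (Eq.trans ?_ (map_coproduct_aH (A := H m ⊗[ℝ] (H m ⊗[ℝ] H m))
      (Algebra.TensorProduct.map (AlgHom.id ℝ (H m)) (coproduct m)) i η).symm)
  have e1 : groupProd (groupProd Y1 Y2) Y3 = groupProd Y1 (groupProd Y2 Y3) :=
    groupProd_assoc _ _ _
  have e2 := congrFun (congrFun e1 i) η
  convert e2 using 2
  · funext i ξ
    simpa using hl i ξ
  · funext i ξ
    simp [Algebra.TensorProduct.one_def]
    rfl
  · funext i ξ
    simp [Algebra.TensorProduct.one_def]
    rfl
  · funext i ξ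
    simpa using hr i ξ

theorem isBialgebra_coproduct : IsBialgebra (coproduct m) (counit m) := by
  refine ⟨fun a => DFunLike.congr_fun coproduct_coassoc a, fun a => ?_, fun a => ?_⟩
  · have h : (Algebra.TensorProduct.map (counit m) (AlgHom.id ℝ (H m))).comp (coproduct m) =
        Algebra.TensorProduct.includeRight := by
      refine algHom_ext_aH fun i η => ?_
      rw [AlgHom.comp_apply, map_coproduct_aH]
      have e := congrFun (congrFun (groupProd_zero_left
        (fun i η => (1 : ℝ) ⊗ₜ[ℝ] aH i η : VecSeries m (ℝ ⊗[ℝ] H m))) i) η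
      refine Eq.trans ?_ e
      congr 1 <;> funext i ξ <;> simp
    exact DFunLike.congr_fun h a
  · have h : (Algebra.TensorProduct.map (AlgHom.id ℝ (H m)) (counit m)).comp (coproduct m) =
        Algebra.TensorProduct.includeLeft := by
      refine algHom_ext_aH fun i η => ?_
      rw [AlgHom.comp_apply, map_coproduct_aH]
      have e := congrFun (congrFun (groupProd_zero_right
        (fun i η => aH i η ⊗ₜ[ℝ] (1 : ℝ) : VecSeries m (H m ⊗[ℝ] ℝ))) i) η
      refine Eq.trans ?_ e
      congr 1 <;> funext i ξ <;> simp
    exact DFunLike.congr_fun h a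

/-- The antipode of `H`, dual to the inverse in the output feedback group. -/
def antipode (m : ℕ) : H m →ₐ[ℝ] H m :=
  MvPolynomial.aeval fun p : Coord m => groupInv (fun i η => aH i η) p.1 p.2

@[simp] theorem antipode_aH (i : Fin m) (η : Word m) :
    antipode m (aH i η) = groupInv (fun i η => aH i η) i η := by
  simp [antipode, aH]

theorem mul'_map {A B C : Type*} [CommRing A] [CommRing B] [CommRing C] [Algebra ℝ A]
    [Algebra ℝ B] [Algebra ℝ C] (F : A →ₐ[ℝ] C) (G : B →ₐ[ℝ] C) (x : A ⊗[ℝ] B) :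
    LinearMap.mul' ℝ C (TensorProduct.map F.toLinearMap G.toLinearMap x) =
      Algebra.TensorProduct.productMap F G x := by
  induction x with
  | zero => simp
  | tmul a b => simp
  | add x y hx hy => simp only [map_add, hx, hy]

/-- The maps μ(S ⊗ id)Δ and μ(id ⊗ S)Δ are algebra morphisms, so generators suffice. There they give
the coefficients of the products of the generic series with its inverse, which are 0. -/
theorem isAntipode_antipode : IsAntipode (coproduct m) (counit m) (antipode m).toLinearMap := by
  constructor
  · intro a
    refine (mul'_map (antipode m) (AlgHom.id ℝ (H m)) _).trans ?_
    have h : (Algebra.TensorProduct.productMap (antipode m) (AlgHom.id ℝ (H m))).comp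
        (coproduct m) = (Algebra.ofId ℝ (H m)).comp (counit m) := by
      refine algHom_ext_aH fun i η => ?_
      rw [AlgHom.comp_apply, map_coproduct_aH]
      have e := congrFun (congrFun (groupInv_groupProd (fun i η => aH i η : VecSeries m (H m)))
        i) η
      simpa using e
    exact DFunLike.congr_fun h a
  · intro a
    refine (mul'_map (AlgHom.id ℝ (H m)) (antipode m) _).trans ?_
    have h : (Algebra.TensorProduct.productMap (AlgHom.id ℝ (H m)) (antipode m)).comp
        (coproduct m) = (Algebra.ofId ℝ (H m)).comp (counit m) := by
      refine algHom_ext_aH fun i η => ?_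
      rw [AlgHom.comp_apply, map_coproduct_aH]
      have e := congrFun (congrFun (groupProd_groupInv (fun i η => aH i η : VecSeries m (H m)))
        i) η
      simpa using e
    exact DFunLike.congr_fun h a

/-- A left and a right convolution inverse of the identity agree. -/
theorem convolution_inverse_unique {R A : Type*} [CommRing R] [CommRing A] [Algebra R A]
    [Coalgebra R A] (S T : A →ₗ[R] A)
    (hT : ∀ a, LinearMap.mul' R A (TensorProduct.map T LinearMap.id (Coalgebra.comul a)) =
      algebraMap R A (Coalgebra.counit a))
    (hS : ∀ a, LinearMap.mul' R A (TensorProduct.map LinearMap.id S (Coalgebra.comul a)) =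
      algebraMap R A (Coalgebra.counit a)) : T = S := by
  have h : WithConv.toConv T = WithConv.toConv S :=
    left_inv_eq_right_inv (a := WithConv.toConv (LinearMap.id : A →ₗ[R] A))
      (WithConv.ofConv_injective (LinearMap.ext hT)) (WithConv.ofConv_injective (LinearMap.ext hS))
  exact WithConv.toConv_injective h

theorem IsAntipode.eq_of_isBialgebra {Δ : H m →ₐ[ℝ] H m ⊗[ℝ] H m} {ε : H m →ₐ[ℝ] ℝ}
    (hb : IsBialgebra Δ ε) {S T : H m →ₗ[ℝ] H m} (hS : IsAntipode Δ ε S)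
    (hT : IsAntipode Δ ε T) : T = S :=
  letI : Coalgebra ℝ (H m) :=
    { comul := Δ.toLinearMap
      counit := ε.toLinearMap
      coassoc := LinearMap.ext hb.1
      rTensor_counit_comp_comul := LinearMap.ext hb.2.1
      lTensor_counit_comp_comul := LinearMap.ext hb.2.2 }
  convolution_inverse_unique S T hT.1 hS.2

theorem antipode_eq_left (i : Fin m) (η : Word m) :
    antipode m (aH i η) = -aH i η - LinearMap.mul' ℝ (H m)
      (TensorProduct.map (antipode m).toLinearMap LinearMap.id (reducedCoproduct (aH i η))) := by
  have h := isAntipode_antipode.1 (aH (m := m) i η)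
  rw [counit_aH, map_zero] at h
  simp only [reducedCoproduct, map_sub, h, TensorProduct.map_tmul, AlgHom.toLinearMap_apply,
    map_one, LinearMap.id_apply, LinearMap.mul'_apply, mul_one, one_mul]
  ring

theorem antipode_eq_right (i : Fin m) (η : Word m) :
    antipode m (aH i η) = -aH i η - LinearMap.mul' ℝ (H m)
      (TensorProduct.map LinearMap.id (antipode m).toLinearMap (reducedCoproduct (aH i η))) := by
  have h := isAntipode_antipode.2 (aH (m := m) i η)
  rw [counit_aH, map_zero] at h
  simp only [reducedCoproduct, map_sub, h, TensorProduct.map_tmul, AlgHom.toLinearMap_apply,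
    map_one, LinearMap.id_apply, LinearMap.mul'_apply, mul_one, one_mul]
  ring

end Hopf

/-! ### The algorithm -/

section Algorithm

variable {m : ℕ}

theorem VPlus.hom_ext {M : Type*} [AddCommMonoid M] [Module ℝ M] {f g : VPlus m →ₗ[ℝ] M}
    (h : ∀ i η, f (aV i η) = g (aV i η)) : f = g :=
  Finsupp.lhom_ext' fun p => LinearMap.ext_ring (h p.1 p.2)

theorem linearCombination_aV {M : Type*} [AddCommMonoid M] [Module ℝ M] (v : Coord m → M)
    (i : Fin m) (η : Word m) : Finsupp.linearCombination ℝ v (aV i η) = v (i, η) := by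
  simp [aV]

@[simp] theorem incl_aV (i : Fin m) (η : Word m) : incl m (aV i η) = aH i η :=
  linearCombination_aV _ i η

@[simp] theorem theta_aV (k : Fin (m + 1)) (i : Fin m) (η : Word m) :
    theta k (aV i η) = aV i (k :: η) := by
  simp [theta, aV]

theorem deg_cons (k : Fin (m + 1)) (η : Word m) :
    deg (k :: η) = deg η + if k = 0 then 2 else 1 := by
  cases k using Fin.cases with
  | zero => simp [deg, (Fin.succ_ne_zero _).symm]; ring
  | succ j => simp [deg, List.count_cons, Finset.sum_add_distrib, Fin.succ_inj]; ring

theorem deg_cons_zero (η : Word m) : deg (0 :: η) = deg η + 2 := by simp [deg_cons]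

theorem deg_cons_succ (j : Fin m) (η : Word m) : deg (j.succ :: η) = deg η + 1 := by
  simp [deg_cons]

theorem deg_pos (η : Word m) : 0 < deg η := Nat.succ_pos _

theorem deg_le_deg_cons (k : Fin (m + 1)) (η : Word m) : deg η ≤ deg (k :: η) := by
  rw [deg_cons]; omega

theorem deg_cons_le_deg_cons {k : Fin (m + 1)} {ξ η : Word m} (h : deg ξ ≤ deg η) :
    deg (k :: ξ) ≤ deg (k :: η) := by
  rw [deg_cons, deg_cons]; omega

theorem shuffleSum_congr {M : Type*} [AddCommMonoid M] {f g : Word m × Word m → M}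
    {η : Word m} (h : ∀ q : Word m × Word m, q.1.length ≤ η.length → f q = g q) :
    shuffleSum f η = shuffleSum g η := by
  induction η generalizing f g with
  | nil => rw [shuffleSum_nil, shuffleSum_nil, h _ le_rfl]
  | cons k η ih =>
    rw [shuffleSum_cons, shuffleSum_cons]
    congr 1 <;> refine ih fun q hq => h _ ?_ <;> simp only [List.length_cons] <;> omega

theorem shuffleSum_mem {M : Type*} [AddCommMonoid M] [Module ℝ M] (p : Submodule ℝ M)
    {f : Word m × Word m → M} {η : Word m}
    (h : ∀ q : Word m × Word m, q.1.length ≤ η.length → deg q.1 ≤ deg η → deg q.2 ≤ deg η →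
      f q ∈ p) :
    shuffleSum f η ∈ p := by
  induction η generalizing f with
  | nil => rw [shuffleSum_nil]; exact h _ le_rfl le_rfl le_rfl
  | cons k η ih =>
    rw [shuffleSum_cons]
    refine p.add_mem (ih fun q h0 h1 h2 => h _ ?_ ?_ ?_) (ih fun q h0 h1 h2 => h _ ?_ ?_ ?_)
    · simpa using h0
    · exact deg_cons_le_deg_cons h1
    · exact h2.trans (deg_le_deg_cons k η)
    · exact h0.trans (by simp)
    · exact h1.trans (deg_le_deg_cons k η)
    · exact deg_cons_le_deg_cons h2

/-! #### The shuffle coproduct -/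

theorem shuffleCoproduct_aV (j i : Fin m) (η : Word m) :
    shuffleCoproduct j (aV i η) = shuffleSum (fun q => aV i q.1 ⊗ₜ[ℝ] aV j q.2) η :=
  linearCombination_aV _ i η

theorem shuffleCoproduct_nil (j i : Fin m) :
    shuffleCoproduct j (aV i []) = aV i [] ⊗ₜ[ℝ] aV j [] := by
  rw [shuffleCoproduct_aV, shuffleSum_nil]

theorem shuffleCoproduct_cons (j i : Fin m) (k : Fin (m + 1)) (η : Word m) :
    shuffleCoproduct j (aV i (k :: η)) = thetaSum k (shuffleCoproduct j (aV i η)) := by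
  simp only [shuffleCoproduct_aV, shuffleSum_cons, thetaSum, LinearMap.add_apply,
    map_shuffleSum (TensorProduct.map _ _), TensorProduct.map_tmul, theta_aV, LinearMap.id_apply]

theorem shuffleCoproduct_comp_theta (j : Fin m) (k : Fin (m + 1)) :
    shuffleCoproduct j ∘ₗ theta k = thetaSum k ∘ₗ shuffleCoproduct j :=
  VPlus.hom_ext fun i η => by
    simp only [LinearMap.comp_apply, theta_aV, shuffleCoproduct_cons]

theorem algShuffle_eq (j : Fin m) : algShuffle j = shuffleCoproduct j := by
  refine VPlus.hom_ext fun i η => ?_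
  rw [algShuffle, linearCombination_aV]
  induction η with
  | nil => rw [shuffleCoproduct_nil]; rfl
  | cons k η ih => rw [shuffleCoproduct_cons, ← ih]; rfl

/-! #### The left-augmented coproduct -/

theorem tildeStep_nil (D : VPlus m →ₗ[ℝ] VPlus m ⊗[ℝ] H m) (i : Fin m) :
    tildeStep D (aV i []) = aV i [] ⊗ₜ[ℝ] (1 : H m) :=
  linearCombination_aV _ i []

theorem tildeStep_zero (D : VPlus m →ₗ[ℝ] VPlus m ⊗[ℝ] H m) (i : Fin m) (η : Word m) :
    tildeStep D (aV i (0 :: η)) = thetaLeft 0 (D (aV i η)) +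
      ∑ j : Fin m, thetaMul j D (shuffleCoproduct j (aV i η)) := by
  simp only [tildeStep, linearCombination_aV, if_true, algShuffle_eq]

theorem tildeStep_succ (D : VPlus m →ₗ[ℝ] VPlus m ⊗[ℝ] H m) (i j : Fin m) (η : Word m) :
    tildeStep D (aV i (j.succ :: η)) = thetaLeft j.succ (D (aV i η)) := by
  simp [tildeStep, linearCombination_aV]

theorem thetaMul_tmul (j : Fin m) (D : VPlus m →ₗ[ℝ] VPlus m ⊗[ℝ] H m) (v w : VPlus m) :
    thetaMul j D (v ⊗ₜ[ℝ] w) = TensorProduct.map (theta j.succ) (LinearMap.mul' ℝ (H m))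
      (TensorProduct.assoc ℝ (VPlus m) (H m) (H m) (D v ⊗ₜ[ℝ] incl m w)) := rfl

theorem tildeStep_congr {D D' : VPlus m →ₗ[ℝ] VPlus m ⊗[ℝ] H m} {η : Word m}
    (h : ∀ i, ∀ ξ : Word m, ξ.length < η.length → D (aV i ξ) = D' (aV i ξ)) (i : Fin m) :
    tildeStep D (aV i η) = tildeStep D' (aV i η) := by
  cases η with
  | nil => rw [tildeStep_nil, tildeStep_nil]
  | cons k η =>
    cases k using Fin.cases with
    | zero =>
      rw [tildeStep_zero, tildeStep_zero, h i η (by simp)]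
      congr 1
      refine Finset.sum_congr rfl fun j _ => ?_
      rw [shuffleCoproduct_aV, map_shuffleSum, map_shuffleSum]
      refine shuffleSum_congr fun q hq => ?_
      rw [thetaMul_tmul, thetaMul_tmul, h i q.1 (by simpa [Nat.lt_succ_iff] using hq)]
    | succ j => rw [tildeStep_succ, tildeStep_succ, h i η (by simp)]

theorem iterate_tildeStep_congr (D D' : VPlus m →ₗ[ℝ] VPlus m ⊗[ℝ] H m) (n p : ℕ) (i : Fin m)
    (η : Word m) (hn : η.length < n) (hp : η.length < p) :
    (tildeStep^[n]) D (aV i η) = (tildeStep^[p]) D' (aV i η) := by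
  induction n generalizing p i η with
  | zero => omega
  | succ n ih =>
    obtain ⟨p, rfl⟩ : ∃ r, p = r + 1 := ⟨p - 1, by omega⟩
    rw [Function.iterate_succ_apply', Function.iterate_succ_apply']
    exact tildeStep_congr (fun i ξ hξ => ih p i ξ (by omega) (by omega)) i

theorem iterate_tildeStep (D : VPlus m →ₗ[ℝ] VPlus m ⊗[ℝ] H m) (n : ℕ) (i : Fin m)
    (η : Word m) (hn : η.length < n) :
    (tildeStep^[n]) D (aV i η) = algTilde m (aV i η) := by
  rw [algTilde, linearCombination_aV]
  exact iterate_tildeStep_congr D 0 n _ i η hn (Nat.lt_succ_self _)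

/-- The iterates are stationary on each word, so their limit is a fixed point; the rules for Δ̃ are
read off from this equation. -/
theorem tildeStep_algTilde (i : Fin m) (η : Word m) :
    tildeStep (algTilde m) (aV i η) = algTilde m (aV i η) := by
  rw [← iterate_tildeStep 0 (η.length + 1) i η (Nat.lt_succ_self _),
    Function.iterate_succ_apply']
  exact tildeStep_congr (fun i ξ hξ => (iterate_tildeStep 0 _ i ξ hξ).symm) i

theorem algTilde_nil (i : Fin m) : algTilde m (aV i []) = aV i [] ⊗ₜ[ℝ] (1 : H m) := by
  rw [← tildeStep_algTilde, tildeStep_nil]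

theorem algTilde_zero (i : Fin m) (η : Word m) :
    algTilde m (aV i (0 :: η)) = thetaLeft 0 (algTilde m (aV i η)) +
      ∑ j : Fin m, thetaMul j (algTilde m) (shuffleCoproduct j (aV i η)) := by
  rw [← tildeStep_algTilde, tildeStep_zero]

theorem algTilde_succ (i j : Fin m) (η : Word m) :
    algTilde m (aV i (j.succ :: η)) = thetaLeft j.succ (algTilde m (aV i η)) := by
  rw [← tildeStep_algTilde, tildeStep_succ]

theorem algTilde_comp_theta_succ (k : Fin m) :
    algTilde m ∘ₗ theta k.succ = thetaLeft k.succ ∘ₗ algTilde m :=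
  VPlus.hom_ext fun i η => by simp only [LinearMap.comp_apply, theta_aV, algTilde_succ]

theorem algTilde_comp_theta_zero :
    algTilde m ∘ₗ theta 0 = thetaLeft 0 ∘ₗ algTilde m +
      ∑ j : Fin m, thetaMul j (algTilde m) ∘ₗ shuffleCoproduct j :=
  VPlus.hom_ext fun i η => by
    simp only [LinearMap.comp_apply, theta_aV, algTilde_zero, LinearMap.add_apply,
      LinearMap.sum_apply]

theorem map_thetaLeft (L : VPlus m →ₗ[ℝ] H m) (k : Fin (m + 1)) (x : VPlus m ⊗[ℝ] H m) :
    TensorProduct.map L LinearMap.id (thetaLeft k x) =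
      TensorProduct.map (L ∘ₗ theta k) LinearMap.id x := by
  induction x with
  | zero => simp
  | tmul v h => simp [thetaLeft]
  | add x y hx hy => simp only [map_add, hx, hy]

theorem map_thetaMul (L : VPlus m →ₗ[ℝ] H m) (j : Fin m)
    (D : VPlus m →ₗ[ℝ] VPlus m ⊗[ℝ] H m) (v w : VPlus m) :
    TensorProduct.map L LinearMap.id (thetaMul j D (v ⊗ₜ[ℝ] w)) =
      TensorProduct.map (L ∘ₗ theta j.succ) LinearMap.id (D v) * 1 ⊗ₜ[ℝ] incl m w := by
  rw [thetaMul_tmul]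
  generalize D v = x
  induction x with
  | zero => simp
  | tmul v h => simp
  | add x y hx hy => simp only [map_add, TensorProduct.add_tmul, add_mul, hx, hy]

theorem EqBelow.trans_eq {R : Type*} {n : ℕ} {c d e : Series m R} (h : EqBelow n c d)
    (hde : d = e) : EqBelow n c e := hde ▸ h

/-- `a^i_η ↦ (L ⊗ id) (Δ̃ a^i_η)` is the modified composition product of a series with the
generic series, for every linear map `L` on `V₊`. -/
theorem modComp_eq_map_algTilde (L : VPlus m →ₗ[ℝ] H m) (i : Fin m) :
    modComp (fun η => L (aV i η) ⊗ₜ[ℝ] (1 : H m)) (genRight m) =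
      fun η => TensorProduct.map L LinearMap.id (algTilde m (aV i η)) := by
  refine eq_of_eqBelow fun n => ?_
  -- `L` must vary: passing to the derivative along x_k replaces `L` by `L ∘ₗ theta k`.
  induction n generalizing L with
  | zero => exact .zero
  | succ n ih =>
    refine EqBelow.succ ?_ ?_ fun j => ?_
    · simp [algTilde_nil]
    · rw [lderiv_modComp_zero]
      have h1 := (ih (L ∘ₗ theta 0)).add (EqBelow.sum (s := Finset.univ) fun j : Fin m =>
        (EqBelow.rfl (c := genRight m j)).shuffle (ih (L ∘ₗ theta j.succ)))
      simp only [LinearMap.comp_apply, theta_aV] at h1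
      refine h1.trans_eq ?_
      funext ξ
      simp only [lderiv_apply, algTilde_zero, map_add, map_thetaLeft, map_sum, Pi.add_apply,
        Finset.sum_apply]
      congr 1
      refine Finset.sum_congr rfl fun j _ => ?_
      -- The shuffle coproduct has the a^j factor on the right, whereas `modComp_cons` has d_j on
      -- the left.
      rw [shuffle_comm, shuffle_eq_shuffleSum, shuffleCoproduct_aV, map_shuffleSum,
        map_shuffleSum]
      simp only [map_thetaMul, incl_aV]
      rfl
    · rw [lderiv_modComp_succ]
      have h1 := ih (L ∘ₗ theta j.succ)
      simp only [LinearMap.comp_apply, theta_aV] at h1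
      refine h1.trans_eq ?_
      funext ξ
      simp only [lderiv_apply, algTilde_succ, map_thetaLeft]

theorem map_incl_algTilde :
    TensorProduct.map (incl m) LinearMap.id ∘ₗ algTilde m = tildeCoproduct m := by
  refine VPlus.hom_ext fun i η => ?_
  have h := congrFun (modComp_eq_map_algTilde (incl m) i) η
  simp only [incl_aV] at h
  simp only [LinearMap.comp_apply, tildeCoproduct, LinearMap.sub_apply, incl_aV,
    AlgHom.toLinearMap_apply, coproduct_aH, TensorProduct.mk_apply, ← h]
  simp only [groupProd, Pi.add_apply]
  exact (add_sub_cancel_left (genRight m i η) _).symm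

theorem reducedCoproduct_aH (i : Fin m) (η : Word m) :
    reducedCoproduct (aH i η) = TensorProduct.map (incl m) LinearMap.id
      (algTilde m (aV i η) - aV i η ⊗ₜ[ℝ] (1 : H m)) := by
  have h := LinearMap.congr_fun (map_incl_algTilde (m := m)) (aV i η)
  rw [LinearMap.comp_apply] at h
  rw [map_sub, h]
  simp only [tildeCoproduct, reducedCoproduct, LinearMap.sub_apply, LinearMap.comp_apply,
    incl_aV, AlgHom.toLinearMap_apply, TensorProduct.mk_apply, TensorProduct.map_tmul,
    LinearMap.id_apply]
  abel

/-! #### The antipode -/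

/-- The subalgebra of `H` generated by the coordinate maps of degree less than `n`. -/
def lowerAlg (m n : ℕ) : Subalgebra ℝ (H m) :=
  Algebra.adjoin ℝ {h | ∃ (i : Fin m) (η : Word m), deg η < n ∧ aH i η = h}

/-- The span in `V₊ ⊗ H` of tensors whose entries only involve coordinate maps of degree
less than `n`. -/
def lowerTensor (m n : ℕ) : Submodule ℝ (VPlus m ⊗[ℝ] H m) :=
  Submodule.span ℝ {x | ∃ (i : Fin m) (η : Word m) (h : H m),
    deg η < n ∧ h ∈ lowerAlg m n ∧ aV i η ⊗ₜ[ℝ] h = x}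

theorem lowerAlg_mono {n k : ℕ} (h : n ≤ k) : lowerAlg m n ≤ lowerAlg m k :=
  Algebra.adjoin_mono fun _ ⟨i, η, hη, e⟩ => ⟨i, η, hη.trans_le h, e⟩

theorem aH_mem_lowerAlg (i : Fin m) {η : Word m} {n : ℕ} (h : deg η < n) :
    aH i η ∈ lowerAlg m n := Algebra.subset_adjoin ⟨i, η, h, rfl⟩

theorem tmul_mem_lowerTensor {i : Fin m} {η : Word m} {h : H m} {n : ℕ} (hη : deg η < n)
    (hh : h ∈ lowerAlg m n) : aV i η ⊗ₜ[ℝ] h ∈ lowerTensor m n :=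
  Submodule.subset_span ⟨i, η, h, hη, hh, rfl⟩

theorem lowerTensor_mono {n k : ℕ} (h : n ≤ k) : lowerTensor m n ≤ lowerTensor m k :=
  Submodule.span_mono fun _ ⟨i, η, a, hη, ha, e⟩ =>
    ⟨i, η, a, hη.trans_le h, lowerAlg_mono h ha, e⟩

theorem thetaLeft_mem_lowerTensor (k : Fin (m + 1)) {η : Word m} {x : VPlus m ⊗[ℝ] H m}
    (hx : x ∈ lowerTensor m (deg η)) : thetaLeft k x ∈ lowerTensor m (deg (k :: η)) := by
  induction hx using Submodule.span_induction with
  | zero => simp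
  | add x y _ _ hx hy => rw [map_add]; exact Submodule.add_mem _ hx hy
  | smul r x _ hx => rw [map_smul]; exact Submodule.smul_mem _ _ hx
  | mem x hx =>
    obtain ⟨i, ξ, h, hξ, hh, rfl⟩ := hx
    rw [thetaLeft, TensorProduct.map_tmul, theta_aV]
    refine tmul_mem_lowerTensor ?_ (lowerAlg_mono (deg_le_deg_cons k η) hh)
    rw [deg_cons, deg_cons]
    omega

theorem map_theta_mul'_mem_lowerTensor (j : Fin m) {n : ℕ} {b : H m}
    (hb : b ∈ lowerAlg m (n + 1)) {x : VPlus m ⊗[ℝ] H m} (hx : x ∈ lowerTensor m n) :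
    TensorProduct.map (theta j.succ) (LinearMap.mul' ℝ (H m))
      (TensorProduct.assoc ℝ (VPlus m) (H m) (H m) (x ⊗ₜ[ℝ] b)) ∈ lowerTensor m (n + 1) := by
  induction hx using Submodule.span_induction with
  | zero => simp
  | add x y _ _ hx hy =>
    rw [TensorProduct.add_tmul, map_add, map_add]; exact Submodule.add_mem _ hx hy
  | smul r x _ hx =>
    rw [← TensorProduct.smul_tmul', map_smul, map_smul]; exact Submodule.smul_mem _ _ hx
  | mem x hx =>
    obtain ⟨i, ξ, h, hξ, hh, rfl⟩ := hx
    rw [TensorProduct.assoc_tmul, TensorProduct.map_tmul, theta_aV, LinearMap.mul'_apply]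
    refine tmul_mem_lowerTensor ?_ (mul_mem (lowerAlg_mono n.le_succ hh) hb)
    rw [deg_cons_succ]
    omega

theorem algReduced_aV (i : Fin m) (η : Word m) :
    algReduced m (aV i η) = algTilde m (aV i η) - aV i η ⊗ₜ[ℝ] (1 : H m) :=
  linearCombination_aV _ i η

/-- This strict drop of degree in both factors makes the antipode recursions terminate. Only the
shuffle terms of the x₀ rule need care: θ_j raises the degree by 1, while passing from η to x₀η
raises it by 2. -/
theorem algReduced_mem_lowerTensor (i : Fin m) (η : Word m) :
    algReduced m (aV i η) ∈ lowerTensor m (deg η) := by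
  suffices h : ∀ n, ∀ η : Word m, η.length < n →
      algReduced m (aV i η) ∈ lowerTensor m (deg η) from h _ η (Nat.lt_succ_self _)
  intro n
  induction n with
  | zero => intro η h; omega
  | succ n ih =>
    rintro (_ | ⟨k, η⟩) hη
    · rw [algReduced_aV, algTilde_nil, sub_self]
      exact Submodule.zero_mem _
    · have hη' : η.length < n := by simpa using hη
      have hk : thetaLeft k (aV i η ⊗ₜ[ℝ] (1 : H m)) = aV i (k :: η) ⊗ₜ[ℝ] 1 := by
        simp [thetaLeft]
      have h1 := thetaLeft_mem_lowerTensor k (ih η hη')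
      rw [algReduced_aV, map_sub, hk] at h1
      rw [algReduced_aV]
      cases k using Fin.cases with
      | succ j => rwa [algTilde_succ]
      | zero =>
        rw [algTilde_zero]
        suffices hs : ∑ j : Fin m, thetaMul j (algTilde m) (shuffleCoproduct j (aV i η)) ∈
            lowerTensor m (deg (0 :: η)) by
          have h2 := Submodule.add_mem _ h1 hs
          convert h2 using 1
          abel
        refine Submodule.sum_mem _ fun j _ => ?_
        rw [shuffleCoproduct_aV, map_shuffleSum]
        refine shuffleSum_mem _ fun q h0 hq1 hq2 => ?_
        rw [thetaMul_tmul, incl_aV, deg_cons_zero]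
        -- The target bound is deg η + 2, and θ_j uses up one unit of it.
        refine map_theta_mul'_mem_lowerTensor (n := deg η + 1) j
          (aH_mem_lowerAlg j (by omega)) ?_
        -- The induction hypothesis concerns the reduced part; the missing term a ⊗ 1, of degree at
        -- most deg η, is added back below.
        have h2 := lowerTensor_mono (k := deg η + 1) (by omega) (ih q.1 (by omega))
        rw [algReduced_aV] at h2
        have h3 : aV i q.1 ⊗ₜ[ℝ] (1 : H m) ∈ lowerTensor m (deg η + 1) :=
          tmul_mem_lowerTensor (by omega) (one_mem _)
        simpa using Submodule.add_mem _ h2 h3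

theorem map_left_of_mem_lowerTensor {S : H m →ₗ[ℝ] H m} {T : VPlus m →ₗ[ℝ] H m} {n : ℕ}
    (hT : ∀ i η, deg η < n → T (aV i η) = S (aH i η)) {x : VPlus m ⊗[ℝ] H m}
    (hx : x ∈ lowerTensor m n) :
    TensorProduct.map T LinearMap.id x =
      TensorProduct.map S LinearMap.id (TensorProduct.map (incl m) LinearMap.id x) := by
  induction hx using Submodule.span_induction with
  | zero => simp
  | add x y _ _ hx hy => simp only [map_add, hx, hy]
  | smul r x _ hx => simp only [map_smul, hx]
  | mem x hx =>
    obtain ⟨i, ξ, h, hξ, hh, rfl⟩ := hx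
    simp [hT i ξ hξ]

/-- The right factors are polynomials in coordinates of low degree, so agreement on those
coordinates carries over only because both maps are multiplicative. -/
theorem map_right_of_mem_lowerTensor {S T : H m →ₐ[ℝ] H m} {n : ℕ}
    (hT : ∀ i η, deg η < n → T (aH i η) = S (aH i η)) {x : VPlus m ⊗[ℝ] H m}
    (hx : x ∈ lowerTensor m n) :
    TensorProduct.map (incl m) T.toLinearMap x =
      TensorProduct.map LinearMap.id S.toLinearMap
        (TensorProduct.map (incl m) LinearMap.id x) := by
  induction hx using Submodule.span_induction with
  | zero => simp
  | add x y _ _ hx hy => simp only [map_add, hx, hy]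
  | smul r x _ hx => simp only [map_smul, hx]
  | mem x hx =>
    obtain ⟨i, ξ, h, hξ, hh, rfl⟩ := hx
    have hle : lowerAlg m n ≤ AlgHom.equalizer T S :=
      Algebra.adjoin_le fun _ ⟨i, η, hη, e⟩ => e ▸ hT i η hη
    have : T h = S h := hle hh
    simp [this]

theorem iterate_antipodeStepLeft (S₀ : VPlus m →ₗ[ℝ] H m) (n : ℕ) (i : Fin m) (η : Word m)
    (h : deg η ≤ n) : (antipodeStepLeft^[n]) S₀ (aV i η) = antipode m (aH i η) := by
  induction n generalizing i η with
  -- Degrees are at least 1, so the arbitrary starting map is never consulted.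
  | zero => exact absurd h (deg_pos η).not_ge
  | succ n ih =>
    rw [Function.iterate_succ_apply', antipode_eq_left, reducedCoproduct_aH, ← algReduced_aV,
      ← map_left_of_mem_lowerTensor (fun i ξ hξ => ih i ξ (by omega))
        (algReduced_mem_lowerTensor i η)]
    simp [antipodeStepLeft]

theorem iterate_antipodeStepRight (S₀ : VPlus m →ₗ[ℝ] H m) (n : ℕ) (i : Fin m) (η : Word m)
    (h : deg η ≤ n) : (antipodeStepRight^[n]) S₀ (aV i η) = antipode m (aH i η) := by
  induction n generalizing i η with
  | zero => exact absurd h (deg_pos η).not_ge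
  | succ n ih =>
    rw [Function.iterate_succ_apply', antipode_eq_right, reducedCoproduct_aH, ← algReduced_aV,
      ← map_right_of_mem_lowerTensor (T := MvPolynomial.aeval (R := ℝ) fun p : Coord m =>
        (antipodeStepRight^[n]) S₀ (aV p.1 p.2)) (fun i ξ hξ => ?_)
        (algReduced_mem_lowerTensor i η)]
    · simp [antipodeStepRight]
    · rw [← ih i ξ (by omega)]
      simp [aH]

end Algorithm

end

end OutputFeedback

/-! ### The main theorem -/

open OutputFeedback in
theorem mainTheorem5 (m : ℕ) :
    -- the coproduct of the output feedback group, and its Hopf algebra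
    (RepresentsProduct (coproduct m) ∧
      ∀ Δ : H m →ₐ[ℝ] H m ⊗[ℝ] H m, RepresentsProduct Δ → Δ = coproduct m) ∧
    IsBialgebra (coproduct m) (counit m) ∧
    ∃ S : H m →ₐ[ℝ] H m,
      IsAntipode (coproduct m) (counit m) S.toLinearMap ∧
      (∀ T : H m →ₗ[ℝ] H m, IsAntipode (coproduct m) (counit m) T → T = S.toLinearMap) ∧
      -- step i
      (∀ j : Fin m,
        algShuffle j = shuffleCoproduct j ∧
        (∀ i : Fin m, shuffleCoproduct j (aV i []) = aV i [] ⊗ₜ[ℝ] aV j []) ∧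
        ∀ k : Fin (m + 1), shuffleCoproduct j ∘ₗ theta k = thetaSum k ∘ₗ shuffleCoproduct j) ∧
      -- step ii
      (TensorProduct.map (incl m) LinearMap.id ∘ₗ algTilde m = tildeCoproduct m ∧
        (∀ i : Fin m, algTilde m (aV i []) = aV i [] ⊗ₜ[ℝ] (1 : H m)) ∧
        (∀ k : Fin m, algTilde m ∘ₗ theta k.succ = thetaLeft k.succ ∘ₗ algTilde m) ∧
        algTilde m ∘ₗ theta 0 = thetaLeft 0 ∘ₗ algTilde m +
          ∑ j : Fin m, thetaMul j (algTilde m) ∘ₗ shuffleCoproduct j ∧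
        ∀ (D : VPlus m →ₗ[ℝ] VPlus m ⊗[ℝ] H m) (i : Fin m) (η : Word m),
          (tildeStep^[η.length + 1]) D (aV i η) = algTilde m (aV i η)) ∧
      -- step iii
      (∀ (i : Fin m) (η : Word m),
        reducedCoproduct (aH i η) =
          TensorProduct.map (incl m) LinearMap.id
            (algTilde m (aV i η) - aV i η ⊗ₜ[ℝ] (1 : H m)) ∧
        S (aH i η) = -aH i η - LinearMap.mul' ℝ (H m)
          (TensorProduct.map S.toLinearMap LinearMap.id (reducedCoproduct (aH i η))) ∧
        S (aH i η) = -aH i η - LinearMap.mul' ℝ (H m)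
          (TensorProduct.map LinearMap.id S.toLinearMap (reducedCoproduct (aH i η))) ∧
        ∀ S₀ : VPlus m →ₗ[ℝ] H m,
          S (aH i η) = (antipodeStepLeft^[deg η]) S₀ (aV i η) ∧
          S (aH i η) = (antipodeStepRight^[deg η]) S₀ (aV i η)) := by
  refine ⟨⟨representsProduct_coproduct, fun _ h => h.eq_coproduct⟩, isBialgebra_coproduct,
    antipode m, isAntipode_antipode,
    fun _ hT => isAntipode_antipode.eq_of_isBialgebra isBialgebra_coproduct hT,
    fun j => ⟨algShuffle_eq j, shuffleCoproduct_nil j, shuffleCoproduct_comp_theta j⟩,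
    ⟨map_incl_algTilde, algTilde_nil, algTilde_comp_theta_succ, algTilde_comp_theta_zero,
      fun D i η => iterate_tildeStep D _ i η (Nat.lt_succ_self _)⟩,
    fun i η => ⟨reducedCoproduct_aH i η, antipode_eq_left i η, antipode_eq_right i η,
      fun S₀ => ⟨(iterate_antipodeStepLeft S₀ _ i η le_rfl).symm,
        (iterate_antipodeStepRight S₀ _ i η le_rfl).symm⟩⟩⟩
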